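/- Let $n\in\mathbb{N}$, $T>0$, $q_0,q_T\in\mathbb{R}^n$, and let $V\in C^2(\mathbb{R}^n,\mathbb{R})$ satisfy $C:=\sup_{q\in\mathbb{R}^n}|V''(q)|<\infty$, where $|\cdot|$ is the operator norm. Let $\mathcal{H}=H^1_0([0,T],\mathbb{R}^n)$ be the Hilbert space of absolutely continuous curves $c:[0,T]\to\mathbb{R}^n$ with square integrable derivative and $c(0)=c(T)=0$, with inner product $\langle c,d\rangle=\int_0^T\dot c(t)\cdot\dot d(t)\,dt$. Define the action functional $$L:\mathcal{H}\to\mathbb{R},\qquad L(c)=\int_0^T\Big(\tfrac12|\dot\gamma(t)|^2-V(\gamma(t))\Big)dt,\qquad \gamma(t)=q_0+\frac{q_T-q_0}{T}\,t+c(t).$$ For $N\in\mathbb{N}=\{0,1,2,\dots\}$ let $\mathcal{U}_N\subset\mathcal{H}$ be the span of the functions $\varphi_k^j(t)=\sqrt{2/T}\,\sin(k\pi t/T)\,e_j$ with $1\le k\le N$, $1\le j\le n$ (where $e_1,\dots,e_n$ is the standard basis of $\mathbb{R}^n$), let $\mathcal{V}_N$ be the orthogonal complement of $\mathcal{U}_N$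 in $\mathcal{H}$, and let $\mathbb{Q}_N$ be the orthogonal projector of $\mathcal{H}$ onto $\mathcal{V}_N$. Then $L$ is Fréchet differentiable on $\mathcal{H}$, with gradient $\nabla L$ given by the Riesz representation theorem. Moreover, if $N\ge\lfloor T\sqrt{C}/\pi\rfloor$, then for every fixed $\bar u\in\mathcal{U}_N$ the map $$F(\bar u,\cdot):\mathcal{V}_N\to\mathcal{V}_N,\qquad v\mapsto \mathbb{Q}_N\nabla L(\bar u+v),$$ is strongly monotone with constant $\mu=1-\dfrac{CT^2}{(\pi(N+1))^2}$; that is, $\mu>0$ and for all $v_1,v_2\in\mathcal{V}_N$ $$\big\langle \mathbb{Q}_N\nabla L(\bar u+v_2)-\mathbb{Q}_N\nabla L(\bar u+v_1),\,v_2-v_1\big\rangle\ \ge\ \mu\,\|v_2-v_1\|^2 .$$ -/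

import Mathlib

open MeasureTheory Set Filter Topology
open scoped Gradient

namespace FiniteReduction

noncomputable section

/-! ### Two facts on absolutely continuous curves in `ℝⁿ` -/

theorem ac_ae_differentiableAt {n : ℕ} {f : ℝ → EuclideanSpace ℝ (Fin n)} {a b : ℝ}
    (hf : AbsolutelyContinuousOnInterval f a b) :
    ∀ᵐ x : ℝ, x ∈ uIcc a b → DifferentiableAt ℝ f x :=
  hf.boundedVariationOn.ae_differentiableAt_of_mem_uIcc

theorem ac_const {n : ℕ} (e : EuclideanSpace ℝ (Fin n)) {a b : ℝ} :
    AbsolutelyContinuousOnInterval (fun _ : ℝ => e) a b := by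
  rw [absolutelyContinuousOnInterval_iff]
  exact fun ε hε => ⟨1, one_pos, fun I _ _ => by simpa using hε⟩

theorem ac_congr {n : ℕ} {f g : ℝ → EuclideanSpace ℝ (Fin n)} {a b : ℝ}
    (hg : AbsolutelyContinuousOnInterval g a b) (h : ∀ x ∈ uIcc a b, f x = g x) :
    AbsolutelyContinuousOnInterval f a b := by
  rw [absolutelyContinuousOnInterval_iff] at hg ⊢
  intro ε hε
  obtain ⟨δ, hδ, h'⟩ := hg ε hε
  refine ⟨δ, hδ, fun I hI hlt => ?_⟩
  refine lt_of_eq_of_lt (Finset.sum_congr rfl fun i hi => ?_) (h' I hI hlt)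
  have hm := hI.1 i hi
  rw [h _ hm.1, h _ hm.2]

theorem ac_primitive {n : ℕ} {g : ℝ → EuclideanSpace ℝ (Fin n)} {a b : ℝ}
    (hg : IntervalIntegrable g volume a b) :
    AbsolutelyContinuousOnInterval (fun x => ∫ t in a..x, g t) a b := by
  have hi : ∀ i : Fin n, IntervalIntegrable (fun t => g t i) volume a b := fun i =>
    ⟨(EuclideanSpace.proj (𝕜 := ℝ) i).integrable_comp hg.1,
      (EuclideanSpace.proj (𝕜 := ℝ) i).integrable_comp hg.2⟩
  have key : ∀ i : Fin n, AbsolutelyContinuousOnInterval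
      (fun x => (∫ t in a..x, g t i) • EuclideanSpace.single i (1 : ℝ)) a b := by
    intro i
    have h1 := (hi i).absolutelyContinuousOnInterval_intervalIntegral (c := a) (by simp)
    have h2 : AbsolutelyContinuousOnInterval
        (fun _ : ℝ => EuclideanSpace.single i (1 : ℝ)) a b := ac_const _
    exact h1.smul h2
  have hsum : ∀ s : Finset (Fin n), AbsolutelyContinuousOnInterval
      (fun x => ∑ i ∈ s, (∫ t in a..x, g t i) • EuclideanSpace.single i (1 : ℝ)) a b := by
    intro s
    induction s using Finset.induction_on with
    | empty => simpa using ac_const (0 : EuclideanSpace ℝ (Fin n))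
    | insert i s his ih =>
      simp only [Finset.sum_insert his]
      exact (key i).add ih
  have hg' : ∀ x ∈ uIcc a b, IntervalIntegrable g volume a x := fun x hx =>
    hg.mono_set (uIcc_subset_uIcc_left hx)
  have heq : ∀ x ∈ uIcc a b, (∫ t in a..x, g t) =
      ∑ i, (∫ t in a..x, g t i) • EuclideanSpace.single i (1 : ℝ) := by
    intro x hx
    ext j
    have := (EuclideanSpace.proj (𝕜 := ℝ) j).intervalIntegral_comp_comm (hg' x hx)
    have h' : ∫ t in a..x, g t j = (∫ t in a..x, g t) j := this
    simp [h', Pi.single_apply]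
  exact ac_congr (hsum Finset.univ) heq

theorem ac_eq_primitive {n : ℕ} {f g : ℝ → EuclideanSpace ℝ (Fin n)} {a b : ℝ}
    (hf : AbsolutelyContinuousOnInterval f a b) (hg : IntervalIntegrable g volume a b)
    (h : ∀ᵐ x : ℝ, x ∈ uIcc a b → deriv f x = g x) :
    ∀ x ∈ uIcc a b, f x = f a + ∫ t in a..x, g t := by
  have hac := hf.sub (ac_primitive hg)
  obtain ⟨K, hK⟩ := hac.const_of_ae_hasDerivAt_zero (by
    filter_upwards [ac_ae_differentiableAt hf, hg.ae_hasDerivAt_integral, h] with x h1 h2 h3 hx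
    have h4 := (h1 hx).hasDerivAt.sub (h2 hx a (by simp))
    rwa [h3 hx, sub_self] at h4)
  intro x hx
  have e1 := hK x hx
  have e2 := hK a (by simp)
  simp only [Pi.sub_apply, intervalIntegral.integral_same, sub_zero] at e1 e2
  rw [e2, ← e1]; abel

/-! ### The loop space `H¹₀([0,T], ℝⁿ)` -/

/-- The vector space underlying `H¹₀([0,T], ℝⁿ)`: the absolutely continuous curves on `[0,T]`
with square integrable derivative which vanish at `0` and at `T`. Such a curve is represented
by its extension by zero to the real line. -/
def loopSubmodule (T : ℝ) (n : ℕ) : Submodule ℝ (ℝ → EuclideanSpace ℝ (Fin n)) where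
  carrier := {c | AbsolutelyContinuousOnInterval c 0 T ∧
    MemLp (deriv c) 2 (volume.restrict (Ioc 0 T)) ∧ ∀ t, t ∉ Ioo 0 T → c t = 0}
  zero_mem' := by
    refine ⟨ac_const 0, ?_, fun t _ => rfl⟩
    have : deriv (0 : ℝ → EuclideanSpace ℝ (Fin n)) = 0 := by
      ext1 t; exact deriv_const t (0 : EuclideanSpace ℝ (Fin n))
    rw [this]; exact MemLp.zero
  add_mem' := by
    rintro c d ⟨hc, hc', hc0⟩ ⟨hd, hd', hd0⟩
    refine ⟨hc.add hd, (hc'.add hd').ae_eq ?_, fun t ht => by simp [hc0 t ht, hd0 t ht]⟩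
    rw [Filter.EventuallyEq, ae_restrict_iff' measurableSet_Ioc]
    filter_upwards [ac_ae_differentiableAt hc, ac_ae_differentiableAt hd] with t h1 h2 ht
    have htu : t ∈ uIcc 0 T := Icc_subset_uIcc (Ioc_subset_Icc_self ht)
    exact (deriv_add (h1 htu) (h2 htu)).symm
  smul_mem' := by
    rintro r c ⟨hc, hc', hc0⟩
    refine ⟨hc.const_smul r, (hc'.const_smul r).ae_eq ?_, fun t ht => by simp [hc0 t ht]⟩
    rw [Filter.EventuallyEq, ae_restrict_iff' measurableSet_Ioc]
    filter_upwards [ac_ae_differentiableAt hc] with t h1 ht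
    have htu : t ∈ uIcc 0 T := Icc_subset_uIcc (Ioc_subset_Icc_self ht)
    exact (deriv_const_smul r (h1 htu)).symm

/-- The Hilbert space `H¹₀([0,T], ℝⁿ)`, with inner product `⟨c, d⟩ = ∫₀ᵀ ċ(t) · ḋ(t) dt`. -/
def LoopSpace (T : ℝ) (n : ℕ) : Type := loopSubmodule T n

namespace LoopSpace

variable {T : ℝ} {n : ℕ}

instance : AddCommGroup (LoopSpace T n) := inferInstanceAs (AddCommGroup (loopSubmodule T n))

instance : Module ℝ (LoopSpace T n) := inferInstanceAs (Module ℝ (loopSubmodule T n))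

/-- The curve `t ↦ c(t)` of a loop `c`. -/
def curve (c : LoopSpace T n) : ℝ → EuclideanSpace ℝ (Fin n) := Subtype.val c

theorem ac (c : LoopSpace T n) : AbsolutelyContinuousOnInterval c.curve 0 T := c.2.1

theorem memLp_deriv (c : LoopSpace T n) :
    MemLp (deriv c.curve) 2 (volume.restrict (Ioc 0 T)) := c.2.2.1

theorem curve_of_notMem (c : LoopSpace T n) {t : ℝ} (ht : t ∉ Ioo 0 T) : c.curve t = 0 :=
  c.2.2.2 t ht

theorem curve_injective : Function.Injective (curve : LoopSpace T n → _) :=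
  Subtype.val_injective

theorem curve_add (c d : LoopSpace T n) : (c + d).curve = c.curve + d.curve := rfl

theorem curve_smul (r : ℝ) (c : LoopSpace T n) : (r • c).curve = r • c.curve := rfl

/-- The velocity of a loop, as a linear map into `L²`. -/
def velocity (T : ℝ) (n : ℕ) :
    LoopSpace T n →ₗ[ℝ] Lp (EuclideanSpace ℝ (Fin n)) 2 (volume.restrict (Ioc 0 T)) where
  toFun c := c.memLp_deriv.toLp _
  map_add' c d := by
    rw [← MemLp.toLp_add, MemLp.toLp_eq_toLp_iff, Filter.EventuallyEq,
      ae_restrict_iff' measurableSet_Ioc]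
    filter_upwards [ac_ae_differentiableAt c.ac, ac_ae_differentiableAt d.ac] with t h1 h2 ht
    have htu : t ∈ uIcc 0 T := Icc_subset_uIcc (Ioc_subset_Icc_self ht)
    exact deriv_add (h1 htu) (h2 htu)
  map_smul' r c := by
    rw [RingHom.id_apply, ← MemLp.toLp_const_smul, MemLp.toLp_eq_toLp_iff, Filter.EventuallyEq,
      ae_restrict_iff' measurableSet_Ioc]
    filter_upwards [ac_ae_differentiableAt c.ac] with t h1 ht
    have htu : t ∈ uIcc 0 T := Icc_subset_uIcc (Ioc_subset_Icc_self ht)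
    exact deriv_const_smul r (h1 htu)

theorem velocity_ae (c : LoopSpace T n) :
    velocity T n c =ᵐ[volume.restrict (Ioc 0 T)] deriv c.curve :=
  c.memLp_deriv.coeFn_toLp

theorem integral_eq_velocity (c d : LoopSpace T n) :
    ∫ t in Ioc 0 T, inner ℝ (deriv c.curve t) (deriv d.curve t) =
      inner ℝ (velocity T n c) (velocity T n d) := by
  rw [L2.inner_def]
  refine integral_congr_ae ?_
  filter_upwards [velocity_ae c, velocity_ae d] with t h1 h2
  rw [h1, h2]

theorem subsingleton (hT : T ≤ 0) : Subsingleton (LoopSpace T n) := by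
  refine ⟨fun c d => curve_injective (funext fun t => ?_)⟩
  have ht : t ∉ Ioo 0 T := by rw [Ioo_eq_empty (not_lt.2 hT)]; simp
  rw [c.curve_of_notMem ht, d.curve_of_notMem ht]

theorem intervalIntegrable (g : Lp (EuclideanSpace ℝ (Fin n)) 2 (volume.restrict (Ioc 0 T)))
    (hT : 0 < T) : IntervalIntegrable g volume 0 T := by
  rw [intervalIntegrable_iff_integrableOn_Ioc_of_le hT.le]
  exact (Lp.memLp g).integrable (by norm_num)

theorem deriv_ae_velocity (c : LoopSpace T n) (hT : 0 < T) :
    ∀ᵐ x : ℝ, x ∈ uIcc 0 T → deriv c.curve x = velocity T n c x := by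
  have h := (ae_restrict_iff' measurableSet_Ioc).1 (velocity_ae c)
  have h0 : ∀ᵐ x : ℝ, x ≠ 0 := by simp [ae_iff, measure_singleton]
  filter_upwards [h, h0] with x hx hx0 hxu
  rw [uIcc_of_le hT.le] at hxu
  exact (hx ⟨lt_of_le_of_ne hxu.1 hx0.symm, hxu.2⟩).symm

theorem curve_eq_integral (c : LoopSpace T n) (hT : 0 < T) {t : ℝ} (ht : t ∈ Icc 0 T) :
    c.curve t = ∫ s in (0 : ℝ)..t, velocity T n c s := by
  have h := ac_eq_primitive c.ac (intervalIntegrable (velocity T n c) hT)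
    (c.deriv_ae_velocity hT) t (by rwa [uIcc_of_le hT.le])
  rwa [c.curve_of_notMem (t := 0) (by simp), zero_add] at h

theorem velocity_injective : Function.Injective (velocity T n) := by
  rcases le_or_gt T 0 with hT | hT
  · have := subsingleton (n := n) hT
    exact Function.injective_of_subsingleton _
  · intro c d h
    refine curve_injective (funext fun t => ?_)
    by_cases ht : t ∈ Ioo 0 T
    · rw [c.curve_eq_integral hT (Ioo_subset_Icc_self ht),
        d.curve_eq_integral hT (Ioo_subset_Icc_self ht), h]
    · rw [c.curve_of_notMem ht, d.curve_of_notMem ht]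

/-- The inner product `⟨c, d⟩ = ∫₀ᵀ ċ · ḋ dt`, the integral being over the interval `(0,T]`. -/
abbrev innerCore (T : ℝ) (n : ℕ) : InnerProductSpace.Core ℝ (LoopSpace T n) where
  inner c d := ∫ t in Ioc 0 T, inner ℝ (deriv c.curve t) (deriv d.curve t)
  conj_inner_symm c d := by
    simp only [integral_eq_velocity, RCLike.conj_to_real]; exact real_inner_comm _ _
  re_inner_nonneg c := by
    simp only [integral_eq_velocity]; exact inner_self_nonneg (𝕜 := ℝ)
  add_left c d e := by simp only [integral_eq_velocity, map_add, inner_add_left]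
  smul_left c d r := by simp only [integral_eq_velocity, map_smul, inner_smul_left]
  definite c h := by
    simp only [integral_eq_velocity, inner_self_eq_zero] at h
    exact velocity_injective (h.trans (map_zero _).symm)

instance : NormedAddCommGroup (LoopSpace T n) := (innerCore T n).toNormedAddCommGroup

instance : InnerProductSpace ℝ (LoopSpace T n) := InnerProductSpace.ofCore (innerCore T n).toCore

theorem inner_def (c d : LoopSpace T n) :
    inner ℝ c d = ∫ t in Ioc 0 T, inner ℝ (deriv c.curve t) (deriv d.curve t) := rfl

theorem norm_velocity (c : LoopSpace T n) : ‖velocity T n c‖ = ‖c‖ := by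
  rw [norm_eq_sqrt_real_inner, norm_eq_sqrt_real_inner, inner_def, integral_eq_velocity]

/-- The velocity as a linear isometry. -/
def velocityₗᵢ (T : ℝ) (n : ℕ) :
    LoopSpace T n →ₗᵢ[ℝ] Lp (EuclideanSpace ℝ (Fin n)) 2 (volume.restrict (Ioc 0 T)) :=
  ⟨velocity T n, norm_velocity⟩

/-- A square integrable function with integral zero is the velocity of a loop. -/
theorem exists_velocity_eq (hT : 0 < T)
    (g : Lp (EuclideanSpace ℝ (Fin n)) 2 (volume.restrict (Ioc 0 T)))
    (hg : ∫ t in Ioc 0 T, g t = 0) : ∃ c : LoopSpace T n, velocity T n c = g := by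
  have hgi := intervalIntegrable g hT
  let f : ℝ → EuclideanSpace ℝ (Fin n) :=
    fun t => if t ∈ Ioo 0 T then ∫ s in (0 : ℝ)..t, g s else 0
  have hfeq : ∀ t ∈ Icc 0 T, f t = ∫ s in (0 : ℝ)..t, g s := by
    intro t ht
    by_cases h : t ∈ Ioo 0 T
    · simp only [f, if_pos h]
    · simp only [f, if_neg h]
      rcases ht.1.eq_or_lt with h0 | h0
      · simp [← h0]
      · have : t = T := le_antisymm ht.2 (not_lt.1 fun h1 => h ⟨h0, h1⟩)
        rw [this, intervalIntegral.integral_of_le hT.le, hg]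
  have hac : AbsolutelyContinuousOnInterval f 0 T :=
    ac_congr (ac_primitive hgi) fun t ht => hfeq t (by rwa [uIcc_of_le hT.le] at ht)
  have hder : ⇑g =ᵐ[volume.restrict (Ioc 0 T)] deriv f := by
    rw [Filter.EventuallyEq, ae_restrict_iff' measurableSet_Ioc]
    have hne : ∀ᵐ x : ℝ, x ≠ T := by simp [ae_iff, measure_singleton]
    filter_upwards [hgi.ae_hasDerivAt_integral, hne] with t h1 h2 ht
    have h3 := h1 (Icc_subset_uIcc (Ioc_subset_Icc_self ht)) 0 (by simp)
    have h4 : f =ᶠ[𝓝 t] fun x => ∫ s in (0 : ℝ)..x, g s := by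
      filter_upwards [Ioo_mem_nhds ht.1 (lt_of_le_of_ne ht.2 h2)] with x hx
      exact hfeq x (Ioo_subset_Icc_self hx)
    exact (h3.congr_of_eventuallyEq h4).deriv.symm
  let c : LoopSpace T n := ⟨f, hac, (Lp.memLp g).ae_eq hder, fun t ht => if_neg ht⟩
  exact ⟨c, Lp.ext ((velocity_ae c).trans hder.symm)⟩

theorem integral_velocity (hT : 0 < T) (c : LoopSpace T n) :
    ∫ t in Ioc 0 T, velocity T n c t = 0 := by
  rw [← intervalIntegral.integral_of_le hT.le, ← c.curve_eq_integral hT (right_mem_Icc.2 hT.le)]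
  exact c.curve_of_notMem (by simp)

instance : CompleteSpace (LoopSpace T n) := by
  rcases le_or_gt T 0 with hT | hT
  · have := subsingleton (n := n) hT
    infer_instance
  · refine (completeSpace_iff_isComplete_range (velocityₗᵢ T n).isometry.isUniformInducing).2 ?_
    refine IsClosed.isComplete ?_
    have hr : range (velocityₗᵢ T n) =
        {g : Lp (EuclideanSpace ℝ (Fin n)) 2 (volume.restrict (Ioc 0 T)) |
          ∀ e : EuclideanSpace ℝ (Fin n), inner ℝ
            (indicatorConstLp 2 MeasurableSet.univ (measure_ne_top _ _) e) g = (0 : ℝ)} := by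
      ext g
      simp only [L2.inner_indicatorConstLp_eq_inner_setIntegral, mem_ofPred_eq,
        Measure.restrict_univ]
      constructor
      · rintro ⟨c, rfl⟩ e
        have : (velocityₗᵢ T n) c = velocity T n c := rfl
        rw [this, integral_velocity hT, inner_zero_right]
      · intro h
        exact exists_velocity_eq hT g (inner_self_eq_zero.1 (h _))
    rw [hr, ofPred_forall]
    exact isClosed_iInter fun e => isClosed_eq (by fun_prop) continuous_const

end LoopSpace

/-! ### The Fourier basis and the splitting -/

/-- The function `φ_kʲ(t) = √(2/T) sin(k π t / T) e_j` of `H¹₀([0,T], ℝⁿ)`. -/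
def fourierMode (T : ℝ) {n : ℕ} (k : ℕ) (j : Fin n) : LoopSpace T n :=
  ⟨fun t => if t ∈ Ioo 0 T then
      EuclideanSpace.single j (√(2 / T) * Real.sin (k * Real.pi * t / T)) else 0, by
    rcases le_or_gt T 0 with hT | hT
    · have h0 : ∀ t : ℝ, t ∉ Ioo 0 T := fun t ht => by linarith [ht.1, ht.2]
      simpa only [h0, if_false] using! (loopSubmodule T n).zero_mem
    let g : ℝ → EuclideanSpace ℝ (Fin n) := fun t =>
      (√(2 / T) * Real.sin (k * Real.pi * t / T)) • EuclideanSpace.single j (1 : ℝ)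
    have hg : ContDiff ℝ 1 g := by
      have h1 : ContDiff ℝ 1 fun t => √(2 / T) * Real.sin (k * Real.pi * t / T) :=
        contDiff_const.mul (Real.contDiff_sin.comp (by fun_prop))
      exact h1.smul contDiff_const
    have hgs : ∀ t, g t = EuclideanSpace.single j (√(2 / T) * Real.sin (k * Real.pi * t / T)) :=
      fun t => by ext i; simp only [g, PiLp.smul_apply, PiLp.single_apply]; split_ifs <;> simp
    refine ⟨ac_congr (g := g) hg.contDiffOn.absolutelyContinuousOnInterval ?_, ?_,
      fun t ht => if_neg ht⟩
    · intro t ht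
      rw [uIcc_of_le hT.le] at ht
      split_ifs with h
      · exact (hgs t).symm
      · rcases ht.1.eq_or_lt with h0 | h0
        · simp [g, ← h0]
        · have : t = T := le_antisymm ht.2 (not_lt.1 fun h1 => h ⟨h0, h1⟩)
          simp [g, this, hT.ne', Real.sin_nat_mul_pi]
    · have hd : Continuous (deriv g) := hg.continuous_deriv le_rfl
      obtain ⟨B, hB⟩ := (isCompact_Icc (a := (0 : ℝ)) (b := T)).exists_bound_of_continuousOn
        hd.continuousOn
      have hL : MemLp (deriv g) 2 (volume.restrict (Ioc 0 T)) := by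
        refine MemLp.of_bound hd.aestronglyMeasurable B ?_
        rw [ae_restrict_iff' measurableSet_Ioc]
        exact ae_of_all _ fun t ht => hB t (Ioc_subset_Icc_self ht)
      refine hL.ae_eq ?_
      rw [Filter.EventuallyEq, ae_restrict_iff' measurableSet_Ioc]
      have hne : ∀ᵐ x : ℝ, x ≠ T := by simp [ae_iff, measure_singleton]
      filter_upwards [hne] with t h2 ht
      refine (Filter.EventuallyEq.deriv_eq ?_).symm
      filter_upwards [Ioo_mem_nhds ht.1 (lt_of_le_of_ne ht.2 h2)] with x hx
      rw [if_pos hx, hgs x]⟩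

/-- `U_N`, the span of the `φ_kʲ` with `1 ≤ k ≤ N`. -/
def lowModes (T : ℝ) (n N : ℕ) : Submodule ℝ (LoopSpace T n) :=
  Submodule.span ℝ {c | ∃ k ∈ Finset.Icc 1 N, ∃ j : Fin n, c = fourierMode T k j}

instance (T : ℝ) (n N : ℕ) : FiniteDimensional ℝ (lowModes T n N) := by
  refine FiniteDimensional.span_of_finite ℝ ?_
  refine (((Finset.Icc 1 N) ×ˢ (Finset.univ : Finset (Fin n))).finite_toSet.image
    fun p => fourierMode T p.1 p.2).subset ?_
  rintro c ⟨k, hk, j, rfl⟩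
  exact ⟨(k, j), by simpa using hk, rfl⟩

/-- `V_N`, the orthogonal complement of `U_N`. -/
abbrev highModes (T : ℝ) (n N : ℕ) : Submodule ℝ (LoopSpace T n) := (lowModes T n N)ᗮ

/-! ### The action functional -/

/-- `∫₀ᵀ (½ |γ̇(t)|² - V(γ(t))) dt`. -/
def curveAction {n : ℕ} (V : EuclideanSpace ℝ (Fin n) → ℝ) (T : ℝ)
    (γ : ℝ → EuclideanSpace ℝ (Fin n)) : ℝ :=
  ∫ t in (0 : ℝ)..T, ((1 / 2) * ‖deriv γ t‖ ^ 2 - V (γ t))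

/-- The curve `ι(c)(t) = q₀ + (t / T) (q_T - q₀) + c(t)` from `q₀` to `q_T`. -/
def pathOfLoop {T : ℝ} {n : ℕ} (q₀ qT : EuclideanSpace ℝ (Fin n)) (c : LoopSpace T n) :
    ℝ → EuclideanSpace ℝ (Fin n) :=
  fun t => q₀ + (t / T) • (qT - q₀) + c.curve t

/-- The action functional `L` on `H¹₀([0,T], ℝⁿ)`. -/
def action {n : ℕ} (V : EuclideanSpace ℝ (Fin n) → ℝ) (T : ℝ)
    (q₀ qT : EuclideanSpace ℝ (Fin n)) (c : LoopSpace T n) : ℝ :=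
  curveAction V T (pathOfLoop q₀ qT c)

/-- `F(ū, v) = Q_N ∇L(ū + v)`, where `Q_N` is the orthogonal projector onto `V_N`. -/
def restrictedGradient {n : ℕ} (V : EuclideanSpace ℝ (Fin n) → ℝ) (T : ℝ)
    (q₀ qT : EuclideanSpace ℝ (Fin n)) (N : ℕ) (u : lowModes T n N) (v : highModes T n N) :
    highModes T n N :=
  (highModes T n N).orthogonalProjectionOnto (∇ (action V T q₀ qT) ((u : LoopSpace T n) + v))

/-- Strong monotonicity, with constant `μ > 0`, of a map of a real inner product space into
itself. -/
def StronglyMonotoneWith {Y : Type*} [NormedAddCommGroup Y] [InnerProductSpace ℝ Y]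
    (μ : ℝ) (f : Y → Y) : Prop :=
  0 < μ ∧ ∀ v₁ v₂ : Y, μ * ‖v₂ - v₁‖ ^ 2 ≤ inner ℝ (f v₂ - f v₁) (v₂ - v₁)

end

end FiniteReduction

/-! Along the affine-plus-loop path the kinetic cross term integrates to zero, because a loop closes
up. Hence `L(c)` is a constant plus `‖c‖²/2` minus the potential term `∫ V(γ)`, and `⟨∇L(c), d⟩ =
⟨c, d⟩ - ∫ V'(γ)(d)` (`action_eq`, `inner_gradient_action`). Differentiability follows because the
Taylor remainder of `V` is pointwise at most `C|d|²`, and `∫ |d|²` is controlled by `‖d‖²` through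
Poincaré's inequality.

Since `V'` is `C`-Lipschitz, `⟨∇L(c + d) - ∇L(c), d⟩ ≥ ‖d‖² - C ∫ |d|²` (`le_inner_gradient_sub`).
For `d` in `V_N` the Wirtinger inequality `∫ |d|² ≤ (T / (π(N+1)))² ‖d‖²` turns this into `μ‖d‖²`,
and the lower bound on `N` says exactly that `T√C < π(N+1)`. The projector is harmless, as the
gradients are tested against an element of `V_N`.

Wirtinger's inequality rests on two Parseval identities: integration by parts makes the cosine
coefficients of `f'` equal to `kπ/T` times the sine coefficients of `f`. Both identities come from
Fourier series on `[-T,T]`, applied to odd and even extensions. -/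

namespace FiniteReduction

/-! ### Sine and cosine expansions on `[0,T]` -/

section Parseval

/-- The extension of `φ` from `(0, ∞)` to the line, even for `σ = 1` and odd for `σ = -1`. -/
noncomputable def reflectExt (σ : ℝ) (φ : ℝ → ℝ) (t : ℝ) : ℂ :=
  if 0 < t then (φ t : ℂ) else (σ * φ (-t) : ℝ)

variable {T : ℝ} {φ : ℝ → ℝ} {σ : ℝ}

/-- Values are prescribed on open intervals only, so the convention of `reflectExt` at `0` and the
endpoints play no role. The codomain is general because the lemma serves both complex Fourier
coefficients and real squared norms. -/
theorem integral_neg_eq_integral_zero {E : Type*} [NormedAddCommGroup E] [NormedSpace ℝ E]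
    {G H K : ℝ → E} (hT : 0 < T) (hH : IntervalIntegrable H volume 0 T)
    (hK : IntervalIntegrable K volume 0 T) (h1 : ∀ t ∈ Ioo 0 T, G t = H t)
    (h2 : ∀ t ∈ Ioo 0 T, G (-t) = K t) :
    ∫ t in (-T)..T, G t = ∫ t in (0 : ℝ)..T, (H t + K t) := by
  have hK' : IntervalIntegrable (fun t => K (-t)) volume (-T) 0 := by
    simpa using ((IntervalIntegrable.iff_comp_neg (f := K) (a := 0) (b := T)).1 hK).symm
  have e1 : ∀ t ∈ Ioo 0 T, H t = G t := fun t ht => (h1 t ht).symm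
  have e2 : ∀ t ∈ Ioo (-T) 0, K (-t) = G t := fun t ht => by
    rw [← h2 (-t) ⟨by linarith [ht.2], by linarith [ht.1]⟩, neg_neg]
  have iH : IntervalIntegrable G volume 0 T := by
    rw [intervalIntegrable_iff_integrableOn_Ioo_of_le hT.le] at hH ⊢
    exact hH.congr_fun e1 measurableSet_Ioo
  have iK : IntervalIntegrable G volume (-T) 0 := by
    rw [intervalIntegrable_iff_integrableOn_Ioo_of_le (by linarith)] at hK' ⊢
    exact hK'.congr_fun e2 measurableSet_Ioo
  rw [← intervalIntegral.integral_add_adjacent_intervals iK iH,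
    intervalIntegral.integral_add hH hK, add_comm,
    intervalIntegral.integral_congr_Ioo_of_le hT.le h1,
    ← intervalIntegral.integral_congr_Ioo_of_le (by linarith) e2,
    intervalIntegral.integral_comp_neg (fun t => K t), neg_zero, neg_neg]

theorem memLp_reflectExt (hT : 0 < T) (hφ : MemLp φ 2 (volume.restrict (Ioc 0 T))) :
    MemLp (reflectExt σ φ) 2 (volume.restrict (Ioc (-T) T)) := by
  have hc : MemLp (fun t => (φ t : ℂ)) 2 (volume.restrict (Ioc 0 T)) := hφ.ofReal
  have hp : MemLp (reflectExt σ φ) 2 (volume.restrict (Ioc 0 T)) := by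
    refine hc.ae_eq ?_
    rw [Filter.EventuallyEq, ae_restrict_iff' measurableSet_Ioc]
    exact ae_of_all _ fun t ht => by simp [reflectExt, ht.1]
  -- Reflection turns `Ioc 0 T` into `Ico (-T) 0`, which differs from `Ioc (-T) 0` by a null set.
  have hmp : MeasurePreserving (fun t : ℝ => -t) (volume.restrict (Ico (-T) 0))
      (volume.restrict (Ioc 0 T)) := by
    have h := (Measure.measurePreserving_neg (volume : Measure ℝ)).restrict_preimage
      (measurableSet_Ioc (a := (0 : ℝ)) (b := T))
    simpa using h
  have hn' : MemLp (fun t => ((σ * φ (-t) : ℝ) : ℂ)) 2 (volume.restrict (Ioc (-T) 0)) := by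
    rw [← restrict_Ico_eq_restrict_Ioc]
    exact ((hφ.const_mul σ).ofReal (K := ℂ)).comp_measurePreserving hmp
  have hn : MemLp (reflectExt σ φ) 2 (volume.restrict (Ioc (-T) 0)) := by
    refine hn'.ae_eq ?_
    rw [Filter.EventuallyEq, ae_restrict_iff' measurableSet_Ioc]
    exact ae_of_all _ fun t ht => by simp [reflectExt, ht.2]
  have hu : Ioc (-T) T = Ioc (-T) 0 ∪ Ioc 0 T :=
    (Ioc_union_Ioc_eq_Ioc (by linarith) hT.le).symm
  have hm := aestronglyMeasurable_union_iff.2 ⟨hn.1, hp.1⟩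
  rw [hu, memLp_two_iff_integrable_sq_norm hm]
  exact IntegrableOn.union ((memLp_two_iff_integrable_sq_norm hn.1).1 hn)
    ((memLp_two_iff_integrable_sq_norm hp.1).1 hp)

/-- Parseval on `[-T,T]` for the extension, with both sides folded onto `[0,T]`. The condition `σ² =
1` gives the two halves equal energy, so the mean over length `2T` becomes a mean over length `T`.
-/
theorem hasSum_sq_reflectExt (hT : 0 < T) (hφ : MemLp φ 2 (volume.restrict (Ioc 0 T)))
    (hσ : σ ^ 2 = 1) :
    HasSum (fun k : ℤ => ‖((1 / (2 * T) : ℝ) : ℂ) * ∫ t in (0 : ℝ)..T,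
      (Complex.exp (-(k * Real.pi * t / T : ℝ) * Complex.I) +
        σ * Complex.exp ((k * Real.pi * t / T : ℝ) * Complex.I)) * φ t‖ ^ 2)
      (T⁻¹ * ∫ t in (0 : ℝ)..T, φ t ^ 2) := by
  have hlt : -T < T := by linarith
  have hφi : IntervalIntegrable φ volume 0 T := by
    rw [intervalIntegrable_iff_integrableOn_Ioc_of_le hT.le]
    exact hφ.integrable (by norm_num)
  have hφc : IntervalIntegrable (fun t => (φ t : ℂ)) volume 0 T := ⟨hφi.1.ofReal, hφi.2.ofReal⟩
  have hφ2 : IntervalIntegrable (fun t => φ t ^ 2) volume 0 T := by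
    rw [intervalIntegrable_iff_integrableOn_Ioc_of_le hT.le]
    exact hφ.integrable_sq
  have h := hasSum_sq_fourierCoeffOn hlt (memLp_reflectExt (σ := σ) hT hφ)
  have hT2 : T - -T = 2 * T := by ring
  convert h using 1
  · ext k
    rw [fourierCoeffOn_eq_integral, hT2, Complex.real_smul]
    congr 3
    have hexp : ∀ s : ℝ, Continuous fun t : ℝ => Complex.exp ((s * t : ℝ) * Complex.I) :=
      fun s => by fun_prop
    -- The period is `2T`, so the basic frequency is `2π/(2T) = π/T`.
    have hker : ∀ t : ℝ, (fourier (-k) (t : AddCircle (2 * T)) : ℂ) =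
        Complex.exp (((-(k * Real.pi / T)) * t : ℝ) * Complex.I) := by
      intro t
      rw [fourier_coe_apply]
      congr 1
      have : (T : ℂ) ≠ 0 := by exact_mod_cast hT.ne'
      push_cast
      field_simp
    rw [integral_neg_eq_integral_zero (T := T)
      (H := fun t => Complex.exp (((-(k * Real.pi / T)) * t : ℝ) * Complex.I) * (φ t : ℂ))
      (K := fun t => Complex.exp (((k * Real.pi / T) * t : ℝ) * Complex.I) * (σ * φ t : ℂ)) hT
      (hφc.continuousOn_mul (hexp _).continuousOn)
      ((hφc.const_mul _).continuousOn_mul (hexp _).continuousOn)]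
    · refine intervalIntegral.integral_congr fun t _ => ?_
      rw [add_mul]
      congr 1
      · congr 2; push_cast; ring
      · rw [mul_comm (σ : ℂ), mul_assoc]; congr 2; push_cast; ring
    · intro t ht
      rw [hker, smul_eq_mul, reflectExt, if_pos ht.1]
    · intro t ht
      rw [hker, smul_eq_mul, reflectExt, if_neg (by linarith [ht.1]), neg_neg]
      push_cast
      congr 3
      ring
  · rw [integral_neg_eq_integral_zero (T := T) (H := fun t => φ t ^ 2) (K := fun t => φ t ^ 2) hT
      hφ2 hφ2, hT2, smul_eq_mul, intervalIntegral.integral_add hφ2 hφ2]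
    · field_simp; ring
    · intro t ht
      simp [reflectExt, ht.1]
    · intro t ht
      have : ¬ (0 < -t) := by linarith [ht.1]
      rw [reflectExt, if_neg this, neg_neg, Complex.norm_real, Real.norm_eq_abs, sq_abs, mul_pow,
        hσ, one_mul]

/-- Parseval's identity for the cosine expansion on `[0,T]`. -/
theorem hasSum_sq_cos (hT : 0 < T) (hφ : MemLp φ 2 (volume.restrict (Ioc 0 T))) :
    HasSum (fun k : ℤ => (T⁻¹ * ∫ t in (0 : ℝ)..T, Real.cos (k * Real.pi * t / T) * φ t) ^ 2)
      (T⁻¹ * ∫ t in (0 : ℝ)..T, φ t ^ 2) := by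
  convert hasSum_sq_reflectExt (σ := 1) hT hφ (by norm_num) using 1
  ext k
  -- Euler's formula; the resulting factor `2` reduces `1/(2T)` to `T⁻¹`.
  have : ∀ t : ℝ, (Complex.exp (-(k * Real.pi * t / T : ℝ) * Complex.I) +
        (1 : ℝ) * Complex.exp ((k * Real.pi * t / T : ℝ) * Complex.I)) * φ t =
      ((2 * (Real.cos (k * Real.pi * t / T) * φ t) : ℝ) : ℂ) := by
    intro t
    rw [Complex.ofReal_mul, Complex.ofReal_mul, Complex.ofReal_cos, Complex.cos]
    push_cast
    ring
  simp_rw [this]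
  rw [intervalIntegral.integral_ofReal, ← Complex.ofReal_mul, Complex.norm_real, Real.norm_eq_abs,
    sq_abs, intervalIntegral.integral_const_mul]
  congr 1
  field_simp

/-- Parseval's identity for the sine expansion on `[0,T]`. -/
theorem hasSum_sq_sin (hT : 0 < T) (hφ : MemLp φ 2 (volume.restrict (Ioc 0 T))) :
    HasSum (fun k : ℤ => (T⁻¹ * ∫ t in (0 : ℝ)..T, Real.sin (k * Real.pi * t / T) * φ t) ^ 2)
      (T⁻¹ * ∫ t in (0 : ℝ)..T, φ t ^ 2) := by
  convert hasSum_sq_reflectExt (σ := -1) hT hφ (by norm_num) using 1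
  ext k
  -- The odd combination of exponentials is `-2i sin`; the unimodular factor `-i` disappears in the
  -- norm.
  have : ∀ t : ℝ, (Complex.exp (-(k * Real.pi * t / T : ℝ) * Complex.I) +
        (-1 : ℝ) * Complex.exp ((k * Real.pi * t / T : ℝ) * Complex.I)) * φ t =
      -Complex.I * ((2 * (Real.sin (k * Real.pi * t / T) * φ t) : ℝ) : ℂ) := by
    intro t
    rw [Complex.ofReal_mul, Complex.ofReal_mul, Complex.ofReal_sin, Complex.sin]
    push_cast
    linear_combination ((Complex.exp (-(k * Real.pi * t / T) * Complex.I) -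
      Complex.exp ((k * Real.pi * t / T) * Complex.I)) * φ t) * Complex.I_mul_I
  simp_rw [this]
  rw [intervalIntegral.integral_const_mul, intervalIntegral.integral_ofReal, mul_left_comm,
    norm_mul, norm_neg, Complex.norm_I, one_mul, ← Complex.ofReal_mul, Complex.norm_real,
    Real.norm_eq_abs, sq_abs, intervalIntegral.integral_const_mul]
  congr 1
  field_simp

end Parseval

/-! ### Wirtinger's inequality -/

theorem memLp_of_continuousOn {E : Type*} [NormedAddCommGroup E] [SecondCountableTopology E]
    {T : ℝ} {f : ℝ → E} (hf : ContinuousOn f (Icc 0 T)) :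
    MemLp f 2 (volume.restrict (Ioc 0 T)) := by
  obtain ⟨B, hB⟩ := isCompact_Icc.exists_bound_of_continuousOn hf
  refine MemLp.of_bound ((hf.mono Ioc_subset_Icc_self).aestronglyMeasurable measurableSet_Ioc) B ?_
  rw [ae_restrict_iff' measurableSet_Ioc]
  exact ae_of_all _ fun t ht => hB t (Ioc_subset_Icc_self ht)

/-- Wirtinger's inequality on `[0,T]` for functions whose first `N` sine coefficients vanish. -/
theorem wirtinger {T : ℝ} (hT : 0 < T) {f g : ℝ → ℝ} (hf : AbsolutelyContinuousOnInterval f 0 T)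
    (hf0 : f 0 = 0) (hfT : f T = 0) (hfg : ∀ᵐ t, t ∈ Ioc 0 T → deriv f t = g t)
    (hg : MemLp g 2 (volume.restrict (Ioc 0 T))) {N : ℕ}
    (horth : ∀ k ∈ Finset.Icc 1 N, ∫ t in (0 : ℝ)..T, Real.cos (k * Real.pi * t / T) * g t = 0) :
    ∫ t in (0 : ℝ)..T, f t ^ 2 ≤
      (T / (Real.pi * (N + 1))) ^ 2 * ∫ t in (0 : ℝ)..T, g t ^ 2 := by
  have hfL : MemLp f 2 (volume.restrict (Ioc 0 T)) :=
    memLp_of_continuousOn (by simpa [uIcc_of_le hT.le] using hf.continuousOn)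
  -- Integration by parts; the boundary terms vanish because `f` is zero at both ends.
  have hparts : ∀ k : ℤ, ∫ t in (0 : ℝ)..T, Real.cos (k * Real.pi * t / T) * g t =
      k * Real.pi / T * ∫ t in (0 : ℝ)..T, Real.sin (k * Real.pi * t / T) * f t := by
    intro k
    have hd : ∀ t : ℝ, HasDerivAt (fun t : ℝ => Real.cos (k * Real.pi * t / T))
        (-(k * Real.pi / T * Real.sin (k * Real.pi * t / T))) t := by
      intro t
      have h1 : HasDerivAt (fun t : ℝ => k * Real.pi * t / T) (k * Real.pi / T) t := by
        simpa using ((hasDerivAt_id t).const_mul (k * Real.pi)).div_const T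
      convert h1.cos using 1
      ring
    have hcos : ContDiff ℝ 1 fun t : ℝ => Real.cos (k * Real.pi * t / T) := by fun_prop
    have h := hcos.contDiffOn.absolutelyContinuousOnInterval.integral_mul_deriv_eq_deriv_mul
      (a := 0) (b := T) hf
    rw [hf0, hfT, mul_zero, mul_zero, sub_self, zero_sub] at h
    calc _ = ∫ t in (0 : ℝ)..T, Real.cos (k * Real.pi * t / T) * deriv f t := by
          refine intervalIntegral.integral_congr_ae ?_
          filter_upwards [hfg] with t ht ht'
          rw [uIoc_of_le hT.le] at ht'
          rw [ht ht']
      _ = _ := by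
          rw [h, ← intervalIntegral.integral_neg, ← intervalIntegral.integral_const_mul]
          refine intervalIntegral.integral_congr fun t _ => ?_
          simp only [(hd t).deriv]
          ring
  have hsin := hasSum_sq_sin hT hfL
  have hcos := (hasSum_sq_cos hT hg).mul_left ((T / (Real.pi * (N + 1))) ^ 2)
  -- The two Parseval series are compared term by term; both run over all of `ℤ`, so the double
  -- counting of `±k` cancels.
  have hle := hasSum_le (fun k : ℤ => ?_) hsin hcos
  · have := mul_le_mul_of_nonneg_left hle hT.le
    field_simp at this ⊢
    linarith
  · rw [← mul_pow, sq_le_sq]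
    -- For `|k| ≥ N + 1` the ratio of the two terms before squaring is `|k|/(N+1) ≥ 1`. For smaller
    -- `|k|` the sine coefficient is zero: trivially at `k = 0`, otherwise by `horth` and `hparts`.
    by_cases hk : (N : ℤ) + 1 ≤ |k|
    · have hk' : (N : ℝ) + 1 ≤ |(k : ℝ)| := by exact_mod_cast hk
      rw [hparts, abs_mul, abs_mul, abs_mul, abs_mul, abs_div, abs_mul, abs_div, abs_mul,
        abs_of_pos Real.pi_pos, abs_of_pos hT, abs_of_nonneg (by positivity : (0 : ℝ) ≤ N + 1)]
      set A := |∫ t in (0 : ℝ)..T, Real.sin (k * Real.pi * t / T) * f t|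
      have : T / (Real.pi * (N + 1)) * (|T⁻¹| * (|(k : ℝ)| * Real.pi / T * A)) =
          |(k : ℝ)| / (N + 1) * (|T⁻¹| * A) := by
        have := Real.pi_pos
        field_simp
      rw [this]
      refine le_mul_of_one_le_left (by positivity) ?_
      rwa [one_le_div (by positivity)]
    · have hz : ∫ t in (0 : ℝ)..T, Real.sin (k * Real.pi * t / T) * f t = 0 := by
        rcases eq_or_ne k 0 with rfl | hk0
        · simp
        have hcz : ∫ t in (0 : ℝ)..T, Real.cos (k * Real.pi * t / T) * g t = 0 := by
          have h := horth k.natAbs (Finset.mem_Icc.2 ⟨by omega, by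
            rw [Int.abs_eq_natAbs] at hk; omega⟩)
          refine Eq.trans ?_ h
          refine intervalIntegral.integral_congr fun t _ => ?_
          have : ((k.natAbs : ℕ) : ℝ) = |(k : ℝ)| := by simp
          simp only [this]
          -- Evenness of the cosine transfers `horth`, stated for positive `k`, to negative `k`.
          rcases abs_choice (k : ℝ) with h' | h' <;> rw [h']
          rw [← Real.cos_neg]
          congr 2
          ring
        rw [hparts] at hcz
        have : (k : ℝ) * Real.pi / T ≠ 0 := by
          have : (k : ℝ) ≠ 0 := by exact_mod_cast hk0
          have := Real.pi_pos
          positivity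
        exact (mul_eq_zero.1 hcz).resolve_left this
      rw [hz, mul_zero, abs_zero]
      positivity

open FiniteReduction.LoopSpace

variable {T : ℝ} {n : ℕ}

/-! ### Curves and velocities of loops -/

theorem continuousOn_curve (hT : 0 < T) (c : LoopSpace T n) : ContinuousOn c.curve (Icc 0 T) := by
  simpa [uIcc_of_le hT.le] using c.ac.continuousOn

theorem ac_coord (c : LoopSpace T n) (j : Fin n) :
    AbsolutelyContinuousOnInterval (fun t => c.curve t j) 0 T := by
  have h := c.ac
  rw [absolutelyContinuousOnInterval_iff] at h ⊢
  intro ε hε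
  obtain ⟨δ, hδ, h'⟩ := h ε hε
  refine ⟨δ, hδ, fun I hI hlt => (Finset.sum_le_sum fun i _ => ?_).trans_lt (h' I hI hlt)⟩
  rw [dist_eq_norm, dist_eq_norm]
  exact PiLp.norm_apply_le (c.curve (I.2 i).1 - c.curve (I.2 i).2) j

theorem deriv_coord_ae (c : LoopSpace T n) (j : Fin n) :
    ∀ᵐ t : ℝ, t ∈ Ioc 0 T → deriv (fun t => c.curve t j) t = deriv c.curve t j := by
  filter_upwards [ac_ae_differentiableAt c.ac] with t h ht
  have h1 := (h (Icc_subset_uIcc (Ioc_subset_Icc_self ht))).hasDerivAt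
  exact ((EuclideanSpace.proj (𝕜 := ℝ) j).hasFDerivAt.comp_hasDerivAt t h1).deriv

theorem memLp_deriv_coord (c : LoopSpace T n) (j : Fin n) :
    MemLp (fun t => deriv c.curve t j) 2 (volume.restrict (Ioc 0 T)) :=
  (EuclideanSpace.proj (𝕜 := ℝ) j).comp_memLp' c.memLp_deriv

theorem norm_sq_eq_integral (hT : 0 < T) (c : LoopSpace T n) :
    ‖c‖ ^ 2 = ∫ t in (0 : ℝ)..T, ‖deriv c.curve t‖ ^ 2 := by
  rw [← real_inner_self_eq_norm_sq, inner_def, intervalIntegral.integral_of_le hT.le]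
  simp only [real_inner_self_eq_norm_sq]

theorem deriv_fourierMode_curve (k : ℕ) (j : Fin n) {t : ℝ} (ht : t ∈ Ioo 0 T) :
    deriv (fourierMode T k j).curve t =
      (√(2 / T) * (k * Real.pi / T) * Real.cos (k * Real.pi * t / T)) •
        EuclideanSpace.single j (1 : ℝ) := by
  have h1 : HasDerivAt (fun t : ℝ => k * Real.pi * t / T) (k * Real.pi / T) t := by
    simpa using ((hasDerivAt_id t).const_mul (k * Real.pi)).div_const T
  have h2 := (h1.sin.const_mul √(2 / T)).smul_const (EuclideanSpace.single j (1 : ℝ))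
  have h3 : (fourierMode T k j).curve =ᶠ[𝓝 t] fun t =>
      (√(2 / T) * Real.sin (k * Real.pi * t / T)) • EuclideanSpace.single j (1 : ℝ) := by
    filter_upwards [Ioo_mem_nhds ht.1 ht.2] with x hx
    have : (fourierMode T k j).curve x =
        EuclideanSpace.single j (√(2 / T) * Real.sin (k * Real.pi * x / T)) := if_pos hx
    rw [this]
    ext i
    simp only [PiLp.smul_apply, PiLp.single_apply]
    split_ifs <;> simp
  rw [h3.deriv_eq, h2.deriv]
  congr 1
  ring

/-- Orthogonality to a mode with `k ≥ 1` thus means that a cosine coefficient of the velocity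
vanishes, which is the hypothesis of `wirtinger`. -/
theorem inner_fourierMode (hT : 0 < T) (k : ℕ) (j : Fin n) (c : LoopSpace T n) :
    inner ℝ (fourierMode T k j) c = √(2 / T) * (k * Real.pi / T) *
      ∫ t in (0 : ℝ)..T, Real.cos (k * Real.pi * t / T) * deriv c.curve t j := by
  rw [inner_def, ← intervalIntegral.integral_of_le hT.le, ← intervalIntegral.integral_const_mul]
  refine intervalIntegral.integral_congr_Ioo_of_le hT.le fun t ht => ?_
  rw [deriv_fourierMode_curve k j ht, real_inner_smul_left, EuclideanSpace.inner_single_left]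
  simp
  ring

/-- Wirtinger's inequality on the space of high modes. -/
theorem integral_sq_le_of_mem_highModes (hT : 0 < T) {N : ℕ} {c : LoopSpace T n}
    (hc : c ∈ highModes T n N) :
    ∫ t in (0 : ℝ)..T, ‖c.curve t‖ ^ 2 ≤ (T / (Real.pi * (N + 1))) ^ 2 * ‖c‖ ^ 2 := by
  have hcoord : ∀ j : Fin n, ∫ t in (0 : ℝ)..T, c.curve t j ^ 2 ≤
      (T / (Real.pi * (N + 1))) ^ 2 * ∫ t in (0 : ℝ)..T, deriv c.curve t j ^ 2 := by
    intro j
    refine wirtinger hT (ac_coord c j) ?_ ?_ (deriv_coord_ae c j) (memLp_deriv_coord c j) ?_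
    · simp [c.curve_of_notMem (t := 0) (by simp)]
    · simp [c.curve_of_notMem (t := T) (by simp)]
    · intro k hk
      have h : inner ℝ (fourierMode T k j) c = 0 :=
        hc _ (Submodule.subset_span ⟨k, hk, j, rfl⟩)
      rw [inner_fourierMode hT] at h
      have hk0 : (0 : ℝ) < k := by exact_mod_cast (Finset.mem_Icc.1 hk).1
      have := Real.pi_pos
      exact (mul_eq_zero.1 h).resolve_left (by positivity)
  rw [norm_sq_eq_integral hT]
  simp only [EuclideanSpace.real_norm_sq_eq]
  rw [intervalIntegral.integral_finsetSum, intervalIntegral.integral_finsetSum, Finset.mul_sum]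
  · exact Finset.sum_le_sum fun j _ => hcoord j
  · intro j _
    rw [intervalIntegrable_iff_integrableOn_Ioc_of_le hT.le]
    exact (memLp_deriv_coord c j).integrable_sq
  · intro j _
    exact ((ac_coord c j).continuousOn.pow 2).intervalIntegrable

/-! ### Poincaré's inequality and the embedding into `L²` -/

/-- Makes Poincaré's inequality the case `N = 0` of Wirtinger's. -/
theorem lowModes_zero : lowModes T n 0 = ⊥ := by
  simp [lowModes]

/-- Poincaré's inequality. -/
theorem integral_sq_le (hT : 0 < T) (c : LoopSpace T n) :
    ∫ t in (0 : ℝ)..T, ‖c.curve t‖ ^ 2 ≤ (T / Real.pi) ^ 2 * ‖c‖ ^ 2 := by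
  have h := integral_sq_le_of_mem_highModes (N := 0) hT (c := c)
    (by rw [highModes, lowModes_zero, Submodule.bot_orthogonal_eq_top]; trivial)
  simpa using h

/-- The embedding of the loop space into `L²`. -/
noncomputable def toL2 (hT : 0 < T) (n : ℕ) :
    LoopSpace T n →L[ℝ] Lp (EuclideanSpace ℝ (Fin n)) 2 (volume.restrict (Ioc 0 T)) :=
  LinearMap.mkContinuous
    { toFun := fun c => (memLp_of_continuousOn (continuousOn_curve hT c)).toLp _
      map_add' := fun _ _ => rfl
      map_smul' := fun _ _ => rfl } (T / Real.pi) fun c => by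
    have hp := Real.pi_pos
    refine le_of_sq_le_sq ?_ (by positivity)
    rw [mul_pow]
    refine le_trans (le_of_eq ?_) (integral_sq_le hT c)
    rw [← real_inner_self_eq_norm_sq, L2.inner_def, intervalIntegral.integral_of_le hT.le]
    refine integral_congr_ae ?_
    filter_upwards [(memLp_of_continuousOn (continuousOn_curve hT c)).coeFn_toLp] with t ht
    rw [← real_inner_self_eq_norm_sq, ← ht]
    rfl

theorem toL2_ae (hT : 0 < T) (c : LoopSpace T n) :
    toL2 hT n c =ᵐ[volume.restrict (Ioc 0 T)] c.curve :=
  (memLp_of_continuousOn (continuousOn_curve hT c)).coeFn_toLp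

/-- Pointwise Riesz representation turns `A` into a square integrable field `a`, and the functional
is the `L²` pairing with `a` after the embedding `toL2`. This supplies the derivative of the
potential term as a bounded functional. -/
theorem exists_clm_eq_integral (hT : 0 < T) {A : ℝ → StrongDual ℝ (EuclideanSpace ℝ (Fin n))}
    (hA : ContinuousOn A (Icc 0 T)) :
    ∃ Φ : LoopSpace T n →L[ℝ] ℝ, ∀ d, Φ d = ∫ t in (0 : ℝ)..T, A t (d.curve t) := by
  let a : ℝ → EuclideanSpace ℝ (Fin n) := fun t => (InnerProductSpace.toDual ℝ _).symm (A t)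
  have ha : ContinuousOn a (Icc 0 T) :=
    (InnerProductSpace.toDual ℝ _).symm.continuous.comp_continuousOn hA
  refine ⟨(innerSL ℝ ((memLp_of_continuousOn ha).toLp a)).comp (toL2 hT n), fun d => ?_⟩
  rw [ContinuousLinearMap.comp_apply, innerSL_apply_apply, L2.inner_def,
    intervalIntegral.integral_of_le hT.le]
  refine integral_congr_ae ?_
  filter_upwards [toL2_ae hT d, (memLp_of_continuousOn ha).coeFn_toLp] with t h1 h2
  rw [h1, h2]
  exact InnerProductSpace.toDual_symm_apply

/-! ### Functions with bounded second derivative -/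

theorem norm_fderiv_sub_le {E : Type*} [NormedAddCommGroup E] [NormedSpace ℝ E] {V : E → ℝ} {C : ℝ}
    (hV : ContDiff ℝ 2 V) (hC : ∀ q, ‖fderiv ℝ (fderiv ℝ V) q‖ ≤ C) (x y : E) :
    ‖fderiv ℝ V y - fderiv ℝ V x‖ ≤ C * ‖y - x‖ :=
  convex_univ.norm_image_sub_le_of_norm_fderiv_le
    (fun q _ => ((hV.fderiv_right (m := 1) (by norm_num)).differentiable (by norm_num)) q)
    (fun q _ => hC q) (mem_univ x) (mem_univ y)

/-- On the segment, `V'` stays within `C‖h‖` of `V'(x)`, and the mean value inequality applies. The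
constant `C` in place of the sharp `C/2` suffices, since only the quadratic order matters for
differentiability. -/
theorem abs_sub_fderiv_le {E : Type*} [NormedAddCommGroup E] [NormedSpace ℝ E] {V : E → ℝ} {C : ℝ}
    (hV : ContDiff ℝ 2 V) (hC : ∀ q, ‖fderiv ℝ (fderiv ℝ V) q‖ ≤ C) (x h : E) :
    |V (x + h) - V x - fderiv ℝ V x h| ≤ C * ‖h‖ ^ 2 := by
  have hC0 : 0 ≤ C := (norm_nonneg (fderiv ℝ (fderiv ℝ V) x)).trans (hC x)
  have := (convex_segment x (x + h)).norm_image_sub_le_of_norm_fderiv_le' (f := V)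
    (φ := fderiv ℝ V x) (C := C * ‖h‖) (fun q _ => hV.differentiable (by norm_num) q)
    (fun q hq => ?_) (left_mem_segment ℝ _ _) (right_mem_segment ℝ _ _)
  · rw [add_sub_cancel_left, Real.norm_eq_abs] at this
    linarith
  · refine (norm_fderiv_sub_le hV hC x q).trans (mul_le_mul_of_nonneg_left ?_ hC0)
    have := norm_sub_le_of_mem_segment hq
    rwa [add_sub_cancel_left] at this

variable {V : EuclideanSpace ℝ (Fin n) → ℝ} {C : ℝ}
  {q₀ qT : EuclideanSpace ℝ (Fin n)}

/-! ### The derivative of the action -/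

theorem continuousOn_pathOfLoop (hT : 0 < T) (c : LoopSpace T n) :
    ContinuousOn (pathOfLoop q₀ qT c) (Icc 0 T) := by
  have h : Continuous fun t : ℝ => q₀ + (t / T) • (qT - q₀) := by fun_prop
  exact h.continuousOn.add (continuousOn_curve hT c)

theorem pathOfLoop_add (c d : LoopSpace T n) (t : ℝ) :
    pathOfLoop q₀ qT (c + d) t = pathOfLoop q₀ qT c t + d.curve t := by
  simp [pathOfLoop, curve_add, add_assoc]

theorem deriv_pathOfLoop_ae (c : LoopSpace T n) :
    ∀ᵐ t : ℝ, t ∈ Ioc 0 T →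
      deriv (pathOfLoop q₀ qT c) t = T⁻¹ • (qT - q₀) + deriv c.curve t := by
  filter_upwards [ac_ae_differentiableAt c.ac] with t h ht
  have h1 := (h (Icc_subset_uIcc (Ioc_subset_Icc_self ht))).hasDerivAt
  have h2 : HasDerivAt (fun t : ℝ => q₀ + (t / T) • (qT - q₀)) (T⁻¹ • (qT - q₀)) t := by
    simpa using (((hasDerivAt_id t).div_const T).smul_const (qT - q₀)).const_add q₀
  exact (h2.add h1).deriv

theorem integral_deriv_curve (hT : 0 < T) (c : LoopSpace T n) :
    ∫ t in Ioc 0 T, deriv c.curve t = 0 := by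
  rw [← integral_velocity hT c]
  exact integral_congr_ae (velocity_ae c).symm

/-- After expanding `‖w + ċ‖²`, the cross term is `⟨w, ∫ ċ⟩ = 0`. All nonquadratic dependence on `c`
is left in the potential. -/
theorem action_eq (hT : 0 < T) (hV : Continuous V) (c : LoopSpace T n) :
    action V T q₀ qT c = T / 2 * ‖T⁻¹ • (qT - q₀)‖ ^ 2 + 1 / 2 * ‖c‖ ^ 2 -
      ∫ t in (0 : ℝ)..T, V (pathOfLoop q₀ qT c t) := by
  set w := T⁻¹ • (qT - q₀)
  have hd1 : Integrable (deriv c.curve) (volume.restrict (Ioc 0 T)) :=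
    c.memLp_deriv.integrable (by norm_num)
  have hd2 : Integrable (fun t => ‖deriv c.curve t‖ ^ 2) (volume.restrict (Ioc 0 T)) :=
    c.memLp_deriv.integrable_norm_pow (by norm_num)
  have hd3 : Integrable (fun t => inner ℝ w (deriv c.curve t)) (volume.restrict (Ioc 0 T)) :=
    hd1.const_inner w
  have hVi : Integrable (fun t => V (pathOfLoop q₀ qT c t)) (volume.restrict (Ioc 0 T)) :=
    ((hV.comp_continuousOn (continuousOn_pathOfLoop hT c)).integrableOn_Icc).mono_set
      Ioc_subset_Icc_self
  have hw : Integrable (fun _ : ℝ => 1 / 2 * ‖w‖ ^ 2) (volume.restrict (Ioc 0 T)) :=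
    integrable_const _
  have hs1 : Integrable (fun t => 1 / 2 * ‖w‖ ^ 2 + inner ℝ w (deriv c.curve t))
      (volume.restrict (Ioc 0 T)) := hw.add hd3
  have hs2 : Integrable (fun t => 1 / 2 * ‖w‖ ^ 2 + inner ℝ w (deriv c.curve t) +
      1 / 2 * ‖deriv c.curve t‖ ^ 2) (volume.restrict (Ioc 0 T)) := hs1.add (hd2.const_mul _)
  rw [action, curveAction, norm_sq_eq_integral hT]
  simp only [intervalIntegral.integral_of_le hT.le]
  calc _ = ∫ t in Ioc 0 T, (1 / 2 * ‖w‖ ^ 2 + inner ℝ w (deriv c.curve t) +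
        1 / 2 * ‖deriv c.curve t‖ ^ 2 - V (pathOfLoop q₀ qT c t)) := by
        refine integral_congr_ae ?_
        rw [Filter.EventuallyEq, ae_restrict_iff' measurableSet_Ioc]
        filter_upwards [deriv_pathOfLoop_ae (q₀ := q₀) (qT := qT) c] with t ht ht'
        rw [ht ht', norm_add_sq_real]
        ring
    _ = _ := by
        rw [integral_sub hs2 hVi,
          integral_add hs1 (hd2.const_mul _), integral_add hw hd3, integral_const,
          integral_const_mul, integral_inner hd1, integral_deriv_curve hT, inner_zero_right]
        simp [hT.le]
        ring

/-- The pointwise quadratic remainder integrates to at most `C ∫ |d|²`, which Poincaré bounds by `C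
(T/π)² ‖d‖²`. -/
theorem isLittleO_integral_remainder (hT : 0 < T) (hV : ContDiff ℝ 2 V)
    (hC : ∀ q, ‖fderiv ℝ (fderiv ℝ V) q‖ ≤ C) (c : LoopSpace T n) :
    (fun d : LoopSpace T n => (∫ t in (0 : ℝ)..T, V (pathOfLoop q₀ qT (c + d) t)) -
      (∫ t in (0 : ℝ)..T, V (pathOfLoop q₀ qT c t)) -
      ∫ t in (0 : ℝ)..T, fderiv ℝ V (pathOfLoop q₀ qT c t) (d.curve t)) =o[𝓝 0] fun d => d := by
  have hC0 : 0 ≤ C := (norm_nonneg (fderiv ℝ (fderiv ℝ V) 0)).trans (hC 0)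
  refine Asymptotics.IsBigO.trans_isLittleO (g := fun d : LoopSpace T n => ‖d‖ ^ 2) ?_
    (Asymptotics.isLittleO_norm_pow_id one_lt_two)
  refine Asymptotics.IsBigO.of_bound (C * (T / Real.pi) ^ 2) (Eventually.of_forall fun d => ?_)
  have hp := continuousOn_pathOfLoop (q₀ := q₀) (qT := qT) hT
  have hi : ∀ e : LoopSpace T n,
      IntervalIntegrable (fun t => V (pathOfLoop q₀ qT e t)) volume 0 T := fun e =>
    ContinuousOn.intervalIntegrable (by
      rw [uIcc_of_le hT.le]; exact hV.continuous.comp_continuousOn (hp e))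
  have hdc := continuousOn_curve hT d
  have hi' : IntervalIntegrable (fun t => fderiv ℝ V (pathOfLoop q₀ qT c t) (d.curve t))
      volume 0 T := ContinuousOn.intervalIntegrable (by
    rw [uIcc_of_le hT.le]
    exact ((hV.continuous_fderiv (by norm_num)).comp_continuousOn (hp c)).clm_apply hdc)
  rw [← intervalIntegral.integral_sub (hi _) (hi _),
    ← intervalIntegral.integral_sub ((hi _).sub (hi _)) hi']
  calc _ ≤ ∫ t in (0 : ℝ)..T, C * ‖d.curve t‖ ^ 2 := by
        refine intervalIntegral.norm_integral_le_of_norm_le hT.le (ae_of_all _ fun t _ => ?_) ?_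
        · rw [pathOfLoop_add]
          exact abs_sub_fderiv_le hV hC _ _
        · refine ContinuousOn.intervalIntegrable ?_
          rw [uIcc_of_le hT.le]
          exact continuousOn_const.mul (hdc.norm.pow 2)
    _ ≤ _ := by
        rw [intervalIntegral.integral_const_mul, norm_pow, norm_norm, mul_assoc]
        exact mul_le_mul_of_nonneg_left (integral_sq_le hT d) hC0

theorem exists_hasFDerivAt_action (hT : 0 < T) (hV : ContDiff ℝ 2 V)
    (hC : ∀ q, ‖fderiv ℝ (fderiv ℝ V) q‖ ≤ C) (c : LoopSpace T n) :
    ∃ Φ : LoopSpace T n →L[ℝ] ℝ, HasFDerivAt (action V T q₀ qT) Φ c ∧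
      ∀ d, Φ d = inner ℝ c d -
        ∫ t in (0 : ℝ)..T, fderiv ℝ V (pathOfLoop q₀ qT c t) (d.curve t) := by
  obtain ⟨Ψ, hΨ⟩ := exists_clm_eq_integral hT (A := fun t => fderiv ℝ V (pathOfLoop q₀ qT c t))
    ((hV.continuous_fderiv (by norm_num)).comp_continuousOn (continuousOn_pathOfLoop hT c))
  have hW : HasFDerivAt (fun e : LoopSpace T n => ∫ t in (0 : ℝ)..T, V (pathOfLoop q₀ qT e t))
      Ψ c := by
    rw [hasFDerivAt_iff_isLittleO_nhds_zero]
    simp only [hΨ]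
    exact isLittleO_integral_remainder hT hV hC c
  have hN := ((hasStrictFDerivAt_norm_sq c).hasFDerivAt.const_mul (1 / 2)).const_add
    (T / 2 * ‖T⁻¹ • (qT - q₀)‖ ^ 2)
  refine ⟨_, (hN.sub hW).congr_of_eventuallyEq
    (Eventually.of_forall fun e => action_eq hT hV.continuous e), fun d => ?_⟩
  simp [hΨ]

theorem inner_gradient_action (hT : 0 < T) (hV : ContDiff ℝ 2 V)
    (hC : ∀ q, ‖fderiv ℝ (fderiv ℝ V) q‖ ≤ C) (c d : LoopSpace T n) :
    inner ℝ (∇ (action V T q₀ qT) c) d = inner ℝ c d -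
      ∫ t in (0 : ℝ)..T, fderiv ℝ V (pathOfLoop q₀ qT c t) (d.curve t) := by
  obtain ⟨Φ, h1, h2⟩ := exists_hasFDerivAt_action (q₀ := q₀) (qT := qT) hT hV hC c
  rw [← h2, ← h1.fderiv, ← toDual_gradient, InnerProductSpace.toDual_apply_apply]

/-! ### Monotonicity of the gradient -/

/-- The quadratic part of the action contributes `‖d‖²` exactly; the potential part loses at most `C
∫ |d|²` because `V'` is `C`-Lipschitz and the two paths differ by `d`. -/
theorem le_inner_gradient_sub (hT : 0 < T) (hV : ContDiff ℝ 2 V)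
    (hC : ∀ q, ‖fderiv ℝ (fderiv ℝ V) q‖ ≤ C) (c d : LoopSpace T n) :
    ‖d‖ ^ 2 - C * ∫ t in (0 : ℝ)..T, ‖d.curve t‖ ^ 2 ≤
      inner ℝ (∇ (action V T q₀ qT) (c + d) - ∇ (action V T q₀ qT) c) d := by
  have hdc := continuousOn_curve hT d
  have hi : ∀ e : LoopSpace T n, IntervalIntegrable
      (fun t => fderiv ℝ V (pathOfLoop q₀ qT e t) (d.curve t)) volume 0 T := fun e =>
    ContinuousOn.intervalIntegrable (by
      rw [uIcc_of_le hT.le]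
      exact ((hV.continuous_fderiv (by norm_num)).comp_continuousOn
        (continuousOn_pathOfLoop hT e)).clm_apply hdc)
  have hle : (∫ t in (0 : ℝ)..T, fderiv ℝ V (pathOfLoop q₀ qT (c + d) t) (d.curve t)) -
      (∫ t in (0 : ℝ)..T, fderiv ℝ V (pathOfLoop q₀ qT c t) (d.curve t)) ≤
      C * ∫ t in (0 : ℝ)..T, ‖d.curve t‖ ^ 2 := by
    rw [← intervalIntegral.integral_sub (hi _) (hi _), ← intervalIntegral.integral_const_mul]
    refine intervalIntegral.integral_mono_on hT.le ((hi _).sub (hi _)) ?_ fun t _ => ?_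
    · refine ContinuousOn.intervalIntegrable ?_
      rw [uIcc_of_le hT.le]
      exact continuousOn_const.mul (hdc.norm.pow 2)
    · have h := norm_fderiv_sub_le hV hC (pathOfLoop q₀ qT c t) (pathOfLoop q₀ qT (c + d) t)
      rw [pathOfLoop_add, add_sub_cancel_left] at h
      rw [pathOfLoop_add, ← sub_apply, sq, ← mul_assoc]
      exact (le_abs_self _).trans ((ContinuousLinearMap.le_opNorm _ _).trans
        (mul_le_mul_of_nonneg_right h (norm_nonneg _)))
  rw [inner_sub_left, inner_gradient_action hT hV hC, inner_gradient_action hT hV hC,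
    inner_add_left, real_inner_self_eq_norm_sq]
  linarith

/-- A number is strictly below its floor plus one, so `T√C/π < N + 1` even when `N` equals the
floor; squaring gives the claim. -/
theorem monotonicityConstant_pos (hC : 0 ≤ C) {N : ℕ}
    (hN : ⌊T * √C / Real.pi⌋ ≤ (N : ℤ)) (hT : 0 < T) :
    0 < 1 - C * T ^ 2 / (Real.pi * (N + 1)) ^ 2 := by
  have hp := Real.pi_pos
  have h1 : T * √C / Real.pi < N + 1 := by
    have h := Int.lt_floor_add_one (T * √C / Real.pi)
    have : ((⌊T * √C / Real.pi⌋ : ℤ) : ℝ) ≤ N := by exact_mod_cast hN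
    linarith
  rw [div_lt_iff₀ hp] at h1
  have h2 := pow_lt_pow_left₀ h1 (by positivity) two_ne_zero
  rw [mul_pow, Real.sq_sqrt hC] at h2
  rw [sub_pos, div_lt_one (by positivity)]
  linarith

end FiniteReduction

theorem proposition1 (n : ℕ) (T : ℝ) (hT : 0 < T)
    (V : EuclideanSpace ℝ (Fin n) → ℝ) (hV : ContDiff ℝ 2 V)
    (C : ℝ) (hC : IsLUB (Set.range fun q => ‖fderiv ℝ (fderiv ℝ V) q‖) C)
    (q₀ qT : EuclideanSpace ℝ (Fin n))
    (N : ℕ) (hN : ⌊T * √C / Real.pi⌋ ≤ (N : ℤ)) :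
    Differentiable ℝ (FiniteReduction.action V T q₀ qT) ∧
    ∀ u : FiniteReduction.lowModes T n N,
      FiniteReduction.StronglyMonotoneWith (1 - C * T ^ 2 / (Real.pi * (N + 1)) ^ 2)
        (FiniteReduction.restrictedGradient V T q₀ qT N u) := by
  have hC' : ∀ q, ‖fderiv ℝ (fderiv ℝ V) q‖ ≤ C := fun q => hC.1 ⟨q, rfl⟩
  have hC0 : 0 ≤ C := (norm_nonneg (fderiv ℝ (fderiv ℝ V) 0)).trans (hC' 0)
  refine ⟨fun c => ?_, fun u =>
    ⟨FiniteReduction.monotonicityConstant_pos hC0 hN hT, fun v₁ v₂ => ?_⟩⟩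
  · obtain ⟨Φ, h, -⟩ := FiniteReduction.exists_hasFDerivAt_action (q₀ := q₀) (qT := qT) hT hV hC' c
    exact h.differentiableAt
  have hmono := FiniteReduction.le_inner_gradient_sub (q₀ := q₀) (qT := qT) hT hV hC'
    ((u : FiniteReduction.LoopSpace T n) + v₁) ((v₂ - v₁ : FiniteReduction.highModes T n N) :)
  have hw := mul_le_mul_of_nonneg_left
    (FiniteReduction.integral_sq_le_of_mem_highModes hT (v₂ - v₁).2) hC0
  -- The increment `v₂ - v₁` taken from the base point `u + v₁` ends at `u + v₂`.
  have hadd : (u : FiniteReduction.LoopSpace T n) + v₁ +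
      ((v₂ - v₁ : FiniteReduction.highModes T n N) :) = u + v₂ := by
    rw [Submodule.coe_sub]; abel
  rw [hadd] at hmono
  unfold FiniteReduction.restrictedGradient
  -- The projector drops out because `v₂ - v₁` lies in `V_N`.
  rw [← map_sub, Submodule.inner_orthogonalProjectionOnto_eq_of_mem_right]
  refine le_trans (le_trans (le_of_eq ?_) (sub_le_sub_left hw _)) hmono
  rw [Submodule.coe_norm, div_pow]
  ring
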